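/- Let $M$ be a smooth manifold (Hausdorff, second countable) of dimension $4m$ with a hypercomplex structure $(I,J,K)$, i.e. integrable complex structures with $IJ=K=-JI$. A metric $g$ on $M$ (nondegenerate, symmetric, Hermitian for $I$, $J$ and $K$) is \emph{HKT} if there is a connection $\nabla$ with $\nabla g=0$, $\nabla I=\nabla J=\nabla K=0$ whose torsion $c(X,Y,Z)=g(X,T(Y,Z))$ is totally skew-symmetric; it is \emph{definite} if it is positive definite or negative definite. A smooth vector field $X$ is a \emph{special homothety of type $(a,b)$}, $a,b\in\mathbb R$, for $(g,I,J,K)$ if $$L_Xg=a\,g,\qquad L_{IX}g=0,\qquad L_{IX}I=0,\qquad L_{IX}J=b\,K,$$ together with the equations obtained from the last three by cyclically permuting $I,J,K$. It \emph{generates a $D(2,1;\alpha)$-symmetry}, $\alpha\in\mathbb R$ finite, if $b\neq0$ and $\alpha+1=a/b$. Suppose that $g$ is a definite HKT metric on $(M,I,J,K)$ with a nowhere zero special homothety $X$ generating a $D(2,1;\alpha)$-symmetry. (i) If $\alpha>0$, then for each $\alpha'>0$ the same hypercomplex manifold $(M,I,J,K)$ admits a definite HKT metric $g'$ with a nowhere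 zero special homothety generating a $D(2,1;\alpha')$-symmetry. (ii) If $\alpha<0$ and $\alpha\neq-1$, then for each $\alpha'<0$ (including $\alpha'=-1$) the same hypercomplex manifold $(M,I,J,K)$ admits a definite HKT metric $g'$ with a nowhere zero special homothety generating a $D(2,1;\alpha')$-symmetry. -/

import Mathlib

open Bundle VectorField
open scoped Manifold ContDiff

noncomputable section

namespace HKT

section

variable {E : Type*} [NormedAddCommGroup E] [NormedSpace ℝ E]
  {H : Type*} [TopologicalSpace H] (I : ModelWithCorners ℝ E H)
  (M : Type*) [TopologicalSpace M] [ChartedSpace H M]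

/-- Vector fields on `M` (not assumed to be continuous). -/
abbrev VField := (x : M) → TangentSpace I x

/-- Fields of endomorphisms of the tangent spaces of `M`. -/
abbrev EndField := (x : M) → TangentSpace I x →L[ℝ] TangentSpace I x

/-- Fields of bilinear forms on the tangent spaces of `M`. -/
abbrev BilinField := (x : M) → TangentSpace I x →L[ℝ] TangentSpace I x →L[ℝ] ℝ

variable {I M}

/-- A field of endomorphisms applied to a vector field. -/
def EndField.app (A : EndField I M) (V : VField I M) : VField I M := fun x ↦ A x (V x)

/-- The function `g(V, W)`. -/
def BilinField.app (g : BilinField I M) (V W : VField I M) : M → ℝ := fun x ↦ g x (V x) (W x)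

/-- Smoothness, as a section of `End(TM)`. -/
def EndField.Smooth [IsManifold I ∞ M] (A : EndField I M) : Prop :=
  ContMDiff I (I.prod 𝓘(ℝ, E →L[ℝ] E)) ∞ fun x ↦ TotalSpace.mk' (E →L[ℝ] E)
    (E := fun x : M ↦ TangentSpace I x →L[ℝ] TangentSpace I x) x (A x)

/-- Smoothness, as a section of `T*M ⊗ T*M`. -/
def BilinField.Smooth [IsManifold I ∞ M] (g : BilinField I M) : Prop :=
  ContMDiff I (I.prod 𝓘(ℝ, E →L[ℝ] E →L[ℝ] ℝ)) ∞ fun x ↦ TotalSpace.mk' (E →L[ℝ] E →L[ℝ] ℝ)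
    (E := fun x : M ↦ TangentSpace I x →L[ℝ] TangentSpace I x →L[ℝ] ℝ) x (g x)

/-- `(L_X g)(V, W) = X(g(V, W)) - g([X, V], W) - g(V, [X, W])`. -/
def lieDerivBilin (X : VField I M) (g : BilinField I M) (V W : VField I M) (x : M) : ℝ :=
  mvfderiv I (g.app V W) x (X x)
    - g x (mlieBracket I X V x) (W x) - g x (V x) (mlieBracket I X W x)

/-- `(L_X A)(V) = [X, A V] - A [X, V]`. -/
def lieDerivEnd (X : VField I M) (A : EndField I M) (V : VField I M) (x : M) :
    TangentSpace I x :=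
  mlieBracket I X (A.app V) x - A x (mlieBracket I X V x)

/-- `L_X g = h` for bilinear forms. Both sides are tensors, so they are compared at each point `x`
on arbitrary vector fields differentiable at `x`. -/
def LieBilinEq [IsManifold I ∞ M] (X : VField I M) (g h : BilinField I M) : Prop :=
  ∀ (V W : VField I M) (x : M), MDiffAt (T% V) x → MDiffAt (T% W) x →
    lieDerivBilin X g V W x = h x (V x) (W x)

/-- `L_X A = B` for endomorphisms, again compared on vector fields differentiable at the point. -/
def LieEndEq [IsManifold I ∞ M] (X : VField I M) (A B : EndField I M) : Prop :=
  ∀ (V : VField I M) (x : M), MDiffAt (T% V) x → lieDerivEnd X A V x = B x (V x)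

/-- The Nijenhuis tensor of `A` vanishes:
`[A V, A W] - A [A V, W] - A [V, A W] - [V, W] = 0` (for `A ^ 2 = -1`). -/
def EndField.NijenhuisZero [IsManifold I ∞ M] (A : EndField I M) : Prop :=
  ∀ (V W : VField I M) (x : M), MDiffAt (T% V) x → MDiffAt (T% W) x →
    mlieBracket I (A.app V) (A.app W) x - A x (mlieBracket I (A.app V) W x)
      - A x (mlieBracket I V (A.app W) x) - mlieBracket I V W x = 0

variable (I M) in
/-- A hypercomplex structure: smooth integrable almost complex structures `I = J 0`, `J = J 1`,
`K = J 2` with `IJ = K`, `JK = I`, `KI = J`. The index set is `Fin 3`, with addition modulo `3`,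
so that "cyclic permutations of `I, J, K`" is a quantification over `n : Fin 3`. -/
structure Hypercomplex [IsManifold I ∞ M] where
  J : Fin 3 → EndField I M
  smooth : ∀ n, (J n).Smooth
  sq : ∀ n x v, J n x (J n x v) = -v
  mul : ∀ n x v, J n x (J (n + 1) x v) = J (n + 2) x v
  integrable : ∀ n, (J n).NijenhuisZero

section structures

variable [IsManifold I ∞ M]

/-- A smooth (pseudo-Riemannian) metric which is Hermitian for `I`, `J` and `K`. -/
structure IsHyperhermitian (Q : Hypercomplex I M) (g : BilinField I M) : Prop where
  smooth : g.Smooth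
  symm : ∀ x u v, g x u v = g x v u
  nondegenerate : ∀ x u, (∀ v, g x u v = 0) → u = 0
  hermitian : ∀ n x u v, g x (Q.J n x u) (Q.J n x v) = g x u v

variable [FiniteDimensional ℝ E] [CompleteSpace E]

/-- `D` is an HKT connection for `(g, I, J, K)`: a smooth connection with `D g = 0`,
`D I = D J = D K = 0`, whose torsion tensor `c(u, v, w) = g(u, T(v, w))` is totally skew.
Here `D V x u` is `D_u V` at `x`. -/
structure IsHKTConnection (Q : Hypercomplex I M) (g : BilinField I M)
    (D : CovariantDerivative I E (TangentSpace I : M → Type _)) : Prop where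
  smooth : CovariantDerivative.ContMDiffCovariantDerivative D ∞
  metric : ∀ (V W : VField I M) (x : M) (u : TangentSpace I x),
    MDiffAt (T% V) x → MDiffAt (T% W) x →
      mvfderiv I (g.app V W) x u = g x (D V x u) (W x) + g x (V x) (D W x u)
  complex : ∀ (n : Fin 3) (V : VField I M) (x : M) (u : TangentSpace I x),
    MDiffAt (T% V) x → D ((Q.J n).app V) x u = Q.J n x (D V x u)
  skew : ∀ (x : M) (u v w : TangentSpace I x),
    g x u (D.torsion x v w) = -g x u (D.torsion x w v) ∧
    g x u (D.torsion x v w) = -g x v (D.torsion x u w)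

/-- `g` is an HKT metric on the hypercomplex manifold `(M, I, J, K)`. -/
structure IsHKT (Q : Hypercomplex I M) (g : BilinField I M) : Prop where
  hyperhermitian : IsHyperhermitian Q g
  exists_connection : ∃ D : CovariantDerivative I E (TangentSpace I : M → Type _),
    IsHKTConnection Q g D

end structures

/-- `g` is positive definite or negative definite. -/
def IsDefinite (g : BilinField I M) : Prop :=
  (∀ x v, v ≠ 0 → 0 < g x v v) ∨ (∀ x v, v ≠ 0 → g x v v < 0)

/-- `X` is a special homothety of type `(a, b)`: it is smooth, `L_X g = a g`, and, with all cyclic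
permutations of `I, J, K`, `L_{IX} g = 0`, `L_{IX} I = 0`, `L_{IX} J = b K`. -/
structure IsSpecialHomothety [IsManifold I ∞ M] (Q : Hypercomplex I M) (g : BilinField I M)
    (X : VField I M) (a b : ℝ) : Prop where
  smooth : CMDiff ∞ (T% X)
  homothety : LieBilinEq X g (fun x ↦ a • g x)
  isometry : ∀ n, LieBilinEq ((Q.J n).app X) g (fun _ ↦ 0)
  holomorphic : ∀ n, LieEndEq ((Q.J n).app X) (Q.J n) (fun _ ↦ 0)
  rotation : ∀ n, LieEndEq ((Q.J n).app X) (Q.J (n + 1)) (fun x ↦ b • Q.J (n + 2) x)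

/-- `X` generates a `D(2,1;α)`-symmetry with `α` finite: it is a special homothety of some type
`(a, b)` with `b ≠ 0` and `α + 1 = a / b`. -/
def GeneratesD21 [IsManifold I ∞ M] (Q : Hypercomplex I M) (g : BilinField I M)
    (X : VField I M) (α : ℝ) : Prop :=
  ∃ a b : ℝ, b ≠ 0 ∧ α + 1 = a / b ∧ IsSpecialHomothety Q g X a b

/-- `(M, I, J, K)` with the metric `g` is a definite HKT manifold on which the nowhere zero
special vector field `X` generates a `D(2,1;α)`-symmetry. -/
structure IsDefiniteHKTWithD21 [IsManifold I ∞ M] [FiniteDimensional ℝ E] [CompleteSpace E]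
    (Q : Hypercomplex I M) (g : BilinField I M) (X : VField I M) (α : ℝ) : Prop where
  hkt : IsHKT Q g
  definite : IsDefinite g
  nowhere_zero : ∀ x, X x ≠ 0
  symmetry : GeneratesD21 Q g X α

end

end HKT

end

/-!
On `M` let `D` be the HKT connection of `g`, `T` its torsion, and `r = g(X, X)`. Everything rests on
the identity `D_u X = (a / 2) u` (`IsSpecialHomothety.cov_X`): since `T` is skew, `L_X g = a g` says
that the symmetric part of `D X` is `a / 2`, while `L_{IX} g = 0` and its cyclic permutations say that
`I D X`, `J D X` and `K D X` are skew, and quaternionic linear algebra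
(`IsHyperhermitianForm.eq_half_smul`) leaves only the homothety. Hence the derivatives of `r` and of
the one-forms `θ₀, …, θ₃` dual to `X`, `IX`, `JX`, `KX` are expressed by `g` and `T`. Moreover
`T(X, ·)` and `T(J_n X, ·) + (a + b) / 2 J_n` commute with `I`, `J` and `K`
(`IsSpecialHomothety.torsion_X_comm`, `IsSpecialHomothety.torsion_J_X_comm`).

The new metric is `g' = |r| ^ κ (g + (c / r) (θ₀² + θ₁² + θ₂² + θ₃²))` (`deformedMetric`), and the
vector field is unchanged.

* The fields `X`, `IX`, `JX`, `KX` are orthogonal of square length `r`, so `g'` multiplies `g` by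
  `|r| ^ κ` off their span and by `|r| ^ κ (1 + c)` on it; it is definite if `1 + c > 0`
  (`isDefinite_deformedMetric`).
* Since `X r = a r` and `IX`, `JX`, `KX` preserve `r` and rotate the `θ_i`, the field `X` is a special
  homothety of type `((κ + 1) a, b)` for `g'` (`IsSpecialHomothety.deformedMetric`).
* If `(a - b) c = a κ`, then `g'` is HKT (`isHKTConnection_deformed`). Its connection is `D + A` for
  an explicit tensor `A` (`correction`) which is algebraic in `g`, `X`, `I`, `J`, `K` and the
  endomorphisms above. It commutes with `I`, `J`, `K` because these endomorphisms do
  (`IsHyperhermitianForm.correction_comm`); preservation of `g'` and skewness of the torsion are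
  identities of hyperhermitian linear algebra (`IsHyperhermitianForm.preCorrection_metric`,
  `IsHyperhermitianForm.preCorrection_torsion`).

With `a = (α + 1) b`, the parameter `α'` requires `κ + 1 = (α' + 1) / (α + 1)`, which makes sense for
`α ≠ -1`. The HKT condition then reads `1 + c = α' / α`, which is positive exactly when `α` and `α'`
have the same sign.
-/

noncomputable section

namespace HKT

/-! ### Hyperhermitian linear algebra -/

section LinearAlgebra

variable {W : Type*} [AddCommGroup W] [Module ℝ W] [TopologicalSpace W]

/-- A hyperhermitian vector space: the linear algebra of a hyperhermitian metric at one point,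
without nondegeneracy. -/
structure IsHyperhermitianForm (g : W →L[ℝ] W →L[ℝ] ℝ) (J : Fin 3 → W →L[ℝ] W) : Prop where
  sq : ∀ n v, J n (J n v) = -v
  mul : ∀ n v, J n (J (n + 1) v) = J (n + 2) v
  symm : ∀ u v, g u v = g v u
  hermitian : ∀ n u v, g (J n u) (J n v) = g u v

namespace IsHyperhermitianForm

variable {g : W →L[ℝ] W →L[ℝ] ℝ} {J : Fin 3 → W →L[ℝ] W} (h : IsHyperhermitianForm g J)
include h

lemma apply_right (n : Fin 3) (u v : W) : g u (J n v) = -g (J n u) v := by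
  have := h.hermitian n u (J n v)
  rw [h.sq] at this
  simpa using this.symm

lemma swap (n : Fin 3) (u v : W) : g (J n u) v = -g (J n v) u := by
  rw [h.symm, h.apply_right]

lemma self (n : Fin 3) (u : W) : g (J n u) u = 0 := by
  linarith [h.swap n u u]

lemma mul_two (n : Fin 3) (v : W) : J n (J (n + 2) v) = -J (n + 1) v := by
  rw [← h.mul n v, h.sq]

lemma mul_rev (n : Fin 3) (v : W) : J (n + 1) (J n v) = -J (n + 2) v := by
  have h1 := h.mul_two (n + 1) v
  have e1 : n + 1 + 2 = n := by fin_cases n <;> rfl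
  have e2 : n + 1 + 1 = n + 2 := by fin_cases n <;> rfl
  rwa [e1, e2] at h1

lemma mul_table (v : W) :
    J 0 (J 1 v) = J 2 v ∧ J 1 (J 2 v) = J 0 v ∧ J 2 (J 0 v) = J 1 v ∧
    J 1 (J 0 v) = -J 2 v ∧ J 2 (J 1 v) = -J 0 v ∧ J 0 (J 2 v) = -J 1 v :=
  ⟨h.mul 0 v, h.mul 1 v, h.mul 2 v, h.mul_rev 0 v, h.mul_rev 1 v, h.mul_two 0 v⟩

/-- The real part of `D X`: an endomorphism whose symmetric part is `a / 2` and whose composites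
with `I`, `J`, `K` are skew is the homothety `a / 2`. The skew part is a two-form of type
`(2, 0) + (0, 2)` for each of `I`, `J` and `K = I J`, hence zero. -/
lemma eq_half_smul (hnd : ∀ u, (∀ v, g u v = 0) → u = 0) {L : W → W} {a : ℝ}
    (h₀ : ∀ u v, g (L u) v + g u (L v) = a * g u v)
    (h₁ : ∀ n u v, g (J n (L u)) v + g u (J n (L v)) = 0) (u : W) :
    L u = (a / 2) • u := by
  have hβ : ∀ n u v, g (L (J n u)) v - a / 2 * g (J n u) v
      = g (L u) (J n v) - a / 2 * g u (J n v) := by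
    intro n u v
    have e1 := h₀ (J n u) v
    have e2 := h₁ n u v
    rw [h.apply_right] at e2
    have e3 := h.apply_right n (L u) v
    rw [h.apply_right n u v]
    linarith
  rw [← sub_eq_zero]
  apply hnd
  intro v
  have key : ∀ v, g (L u) (J 2 v) - a / 2 * g u (J 2 v) = 0 := by
    intro v
    have e1 := hβ 2 u v
    have e2 := hβ 0 (J 1 u) v
    have e3 := hβ 1 u (J 0 v)
    rw [(h.mul_table u).1] at e2
    rw [(h.mul_table v).2.2.2.1] at e3
    simp only [map_neg] at e3
    linarith
  have := key (J 2 v)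
  rw [h.sq] at this
  simp only [map_neg] at this
  simp only [map_sub, map_smul, sub_apply, smul_apply,
    smul_eq_mul]
  linarith

end IsHyperhermitianForm

variable [IsTopologicalAddGroup W] [ContinuousSMul ℝ W]
  (g : W →L[ℝ] W →L[ℝ] ℝ) (J : Fin 3 → W →L[ℝ] W)

/-- The quaternionic-linear map of quaternionic rank one `v ↦ ⟨z, v⟩ q` attached to two
vectors `z` and `q`. -/
def quatRankOne (z q : W) : W →L[ℝ] W :=
  (g z).smulRight q + ∑ n, (g (J n z)).smulRight (J n q)

lemma quatRankOne_apply (z q v : W) :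
    quatRankOne g J z q v = g z v • q +
      (g (J 0 z) v • J 0 q + g (J 1 z) v • J 1 q + g (J 2 z) v • J 2 q) := by
  simp [quatRankOne, Fin.sum_univ_three]

/-- The bilinear form `φ g + ψ (θ₀² + θ₁² + θ₂² + θ₃²)`, where `θ₀, …, θ₃` are dual under `g` to
`X`, `I X`, `J X` and `K X`. It is hyperhermitian if `g` is. -/
def deformedForm (X : W) (φ ψ : ℝ) : W →L[ℝ] W →L[ℝ] ℝ :=
  φ • g + ψ • (g ∘L quatRankOne g J X X)

variable {g J}

lemma deformedForm_apply (X u v : W) (φ ψ : ℝ) :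
    deformedForm g J X φ ψ u v = φ * g u v + ψ * (g X u * g X v +
      (g (J 0 X) u * g (J 0 X) v + g (J 1 X) u * g (J 1 X) v + g (J 2 X) u * g (J 2 X) v)) := by
  simp only [deformedForm, quatRankOne_apply, add_apply, smul_apply, smul_eq_mul,
    ContinuousLinearMap.comp_apply, map_add, map_smul]

namespace IsHyperhermitianForm

variable (h : IsHyperhermitianForm g J)
include h

lemma quatRankOne_comm (n : Fin 3) (z q v : W) :
    quatRankOne g J z q (J n v) = J n (quatRankOne g J z q v) := by
  have t := h.mul_table
  fin_cases n <;>
  · simp only [quatRankOne_apply, map_add, map_smul, Fin.zero_eta, Fin.mk_one, Fin.reduceFinMk,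
      h.apply_right, (t _).1, (t _).2.1, (t _).2.2.1, (t _).2.2.2.1, (t _).2.2.2.2.1,
      (t _).2.2.2.2.2, h.sq, map_neg, neg_apply, neg_neg]
    module

lemma deformed_symm (X u v : W) (φ ψ : ℝ) :
    deformedForm g J X φ ψ u v = deformedForm g J X φ ψ v u := by
  simp only [deformedForm_apply, h.symm u v]
  ring

lemma deformed_hermitian (X : W) (φ ψ : ℝ) (n : Fin 3) (u v : W) :
    deformedForm g J X φ ψ (J n u) (J n v) = deformedForm g J X φ ψ u v := by
  simp only [deformedForm, add_apply, smul_apply,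
    ContinuousLinearMap.comp_apply, h.quatRankOne_comm, h.hermitian]

/-- `X`, `I X`, `J X` and `K X` are orthogonal, of the same square length. -/
lemma quatRankOne_self (X : W) : quatRankOne g J X X X = g X X • X := by
  simp [quatRankOne_apply, h.self]

lemma quatRankOne_idem (X v : W) :
    quatRankOne g J X X (quatRankOne g J X X v) = g X X • quatRankOne g J X X v := by
  conv_lhs => rw [quatRankOne_apply g J X X v]
  conv_rhs => rw [quatRankOne_apply g J X X v]
  simp only [map_add, map_smul, h.quatRankOne_comm, h.quatRankOne_self]
  module

lemma apply_quatRankOne (X u v : W) :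
    g u (quatRankOne g J X X v) = g (quatRankOne g J X X u) v := by
  simp only [quatRankOne_apply, map_add, map_smul, add_apply,
    smul_apply, smul_eq_mul, h.symm u]
  ring

/-- Definiteness of the deformed form. By orthogonality of `X`, `I X`, `J X`, `K X`, the form
is the sum of `φ g` on the orthogonal complement of their span and of
`φ (1 + c) g` on the span, with `c = ψ g(X, X) / φ`. -/
lemma deformed_pos {ε : ℝ} (hg : ∀ v, v ≠ 0 → 0 < ε * g v v) {X : W} (hX : X ≠ 0) {φ c : ℝ}
    (hφ : 0 < φ) (hc : 0 < 1 + c) {v : W} (hv : v ≠ 0) :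
    0 < ε * deformedForm g J X φ (φ * c / g X X) v v := by
  have hr := hg X hX
  have hr0 : g X X ≠ 0 := by rintro h0; simp [h0] at hr
  set R := quatRankOne g J X X
  have nonneg : ∀ w, 0 ≤ ε * g w w := by
    intro w
    rcases eq_or_ne w 0 with rfl | hw
    · simp
    · exact (hg w hw).le
  -- the orthogonal projection of `v` to the span
  set p : W := (g X X)⁻¹ • R v
  set w : W := v - p
  have hvw : v = w + p := by simp [w]
  have hRp : R p = R v := by
    simp only [p, map_smul, R, h.quatRankOne_idem, smul_smul, inv_mul_cancel₀ hr0, one_smul]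
  have hRw : R w = 0 := by simp [w, hRp]
  have hwp : g w p = 0 := by
    simp only [p, map_smul, R, h.apply_quatRankOne]
    change _ • g (R w) v = 0
    simp [hRw]
  have hgv : g v v = g w w + g p p := by
    rw [hvw]
    simp only [map_add, add_apply, hwp, h.symm p w]
    ring
  have hgR : g (R v) v = g X X * g p p := by
    have e1 : R v = g X X • p := by simp [p, smul_smul, mul_inv_cancel₀ hr0]
    rw [e1, hvw]
    simp only [map_add, map_smul, smul_apply, h.symm p w,
      hwp, smul_eq_mul]
    ring
  have hval : ε * deformedForm g J X φ (φ * c / g X X) v v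
      = φ * (ε * g w w + (1 + c) * (ε * g p p)) := by
    simp only [deformedForm, add_apply, smul_apply,
      ContinuousLinearMap.comp_apply, smul_eq_mul]
    change ε * (φ * g v v + φ * c / g X X * g (R v) v) = _
    rw [hgR, hgv]
    field_simp
    ring
  rw [hval]
  apply mul_pos hφ
  by_cases hp : p = 0
  · have hw : w ≠ 0 := by rintro h0; exact hv (by rw [hvw, hp, h0, add_zero])
    exact add_pos_of_pos_of_nonneg (hg w hw) (mul_nonneg hc.le (nonneg p))
  · exact add_pos_of_nonneg_of_pos (nonneg w) (mul_pos hc (hg p hp))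

end IsHyperhermitianForm

end LinearAlgebra

/-! ### The difference of two HKT connections -/

section ConnectionAlgebra

variable {W : Type*} [AddCommGroup W] [Module ℝ W] [TopologicalSpace W]
  [IsTopologicalAddGroup W] [ContinuousSMul ℝ W]
  (g : W →L[ℝ] W →L[ℝ] ℝ) (J : Fin 3 → W →L[ℝ] W) (X : W)
  (S₀ : W → W) (S : Fin 3 → W → W) (l p t y : ℝ)

/-- The endomorphism `B_u` for which `g'(w, A_u v) = φ g(w, B_u v)`, where `g'` is the deformed form
and `A` is the difference of the HKT connections of `g'` and `g`. Here `l = ψ / φ`, and `S₀`, `S n`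
stand for the skew quaternionic-linear endomorphisms `T(X, ·)` and `T(J_n X, ·) + (a + b) / 2 J_n`
made from the torsion `T` of the HKT connection of `g`. -/
def preCorrection (u v : W) : W :=
  l • (g X u • S₀ v + (g (J 0 X) u • S 0 v + g (J 1 X) u • S 1 v + g (J 2 X) u • S 2 v))
    + (p * g X u) • v + quatRankOne g J X (p • u + y • quatRankOne g J X X u) v
    + t • quatRankOne g J u X v

/-- The difference of the HKT connections of the deformed form and of `g`, in the direction `u`
and applied to `v`. With `l = ψ / φ` and `r = g(X, X)`, the endomorphism
`1 - l / (1 + l r) ⟨X, ·⟩ X` is the inverse of `1 + l ⟨X, ·⟩ X`, which relates the two forms up to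
the factor `φ`. -/
def correction (u v : W) : W :=
  preCorrection g J X S₀ S l p t y u v - (l / (1 + l * g X X)) •
    quatRankOne g J X X (preCorrection g J X S₀ S l p t y u v)

variable {g J X S₀ S l p t y}

lemma quatRankOne_add_left (z z' q v : W) :
    quatRankOne g J (z + z') q v = quatRankOne g J z q v + quatRankOne g J z' q v := by
  simp only [quatRankOne_apply, map_add, add_apply]
  module

lemma quatRankOne_smul_left (s : ℝ) (z q v : W) :
    quatRankOne g J (s • z) q v = s • quatRankOne g J z q v := by
  simp only [quatRankOne_apply, map_smul, smul_apply, smul_eq_mul]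
  module

lemma quatRankOne_add_mid (z q q' v : W) :
    quatRankOne g J z (q + q') v = quatRankOne g J z q v + quatRankOne g J z q' v := by
  simp only [quatRankOne_apply, map_add]
  module

lemma quatRankOne_smul_mid (s : ℝ) (z q v : W) :
    quatRankOne g J z (s • q) v = s • quatRankOne g J z q v := by
  simp only [quatRankOne_apply, map_smul]
  module

lemma preCorrection_add_left (u u' v : W) : preCorrection g J X S₀ S l p t y (u + u') v =
    preCorrection g J X S₀ S l p t y u v + preCorrection g J X S₀ S l p t y u' v := by
  simp only [preCorrection, map_add, quatRankOne_add_left, quatRankOne_add_mid,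
    quatRankOne_smul_mid]
  module

lemma preCorrection_smul_left (s : ℝ) (u v : W) : preCorrection g J X S₀ S l p t y (s • u) v =
    s • preCorrection g J X S₀ S l p t y u v := by
  simp only [preCorrection, map_smul, quatRankOne_smul_left, quatRankOne_add_mid,
    quatRankOne_smul_mid, smul_eq_mul]
  module

lemma correction_add_left (u u' v : W) : correction g J X S₀ S l p t y (u + u') v =
    correction g J X S₀ S l p t y u v + correction g J X S₀ S l p t y u' v := by
  simp only [correction, preCorrection_add_left, map_add]
  module

lemma correction_smul_left (s : ℝ) (u v : W) : correction g J X S₀ S l p t y (s • u) v =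
    s • correction g J X S₀ S l p t y u v := by
  simp only [correction, preCorrection_smul_left, map_smul]
  module

lemma preCorrection_add_right {S₀ : W →L[ℝ] W} {S : Fin 3 → W →L[ℝ] W} (u v v' : W) :
    preCorrection g J X S₀ (fun n ↦ S n) l p t y u (v + v') =
    preCorrection g J X S₀ (fun n ↦ S n) l p t y u v +
      preCorrection g J X S₀ (fun n ↦ S n) l p t y u v' := by
  simp only [preCorrection, map_add]
  module

lemma preCorrection_smul_right {S₀ : W →L[ℝ] W} {S : Fin 3 → W →L[ℝ] W} (s : ℝ) (u v : W) :
    preCorrection g J X S₀ (fun n ↦ S n) l p t y u (s • v) =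
    s • preCorrection g J X S₀ (fun n ↦ S n) l p t y u v := by
  simp only [preCorrection, map_smul]
  module

lemma correction_congr {S₀' : W → W} {S' : Fin 3 → W → W} {u v : W} (h₀ : S₀ v = S₀' v)
    (hS : ∀ n, S n v = S' n v) :
    correction g J X S₀ S l p t y u v = correction g J X S₀' S' l p t y u v := by
  simp only [correction, preCorrection, h₀, hS]

lemma isBilinearMap_correction (S₀ : W →L[ℝ] W) (S : Fin 3 → W →L[ℝ] W) :
    IsBilinearMap ℝ fun v u ↦ correction g J X S₀ (fun n ↦ S n) l p t y u v where
  add_left v v' u := by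
    simp only [correction, preCorrection_add_right, map_add]
    module
  smul_left s v u := by
    simp only [correction, preCorrection_smul_right, map_smul]
    module
  add_right v u u' := correction_add_left u u' v
  smul_right s v u := correction_smul_left s u v

namespace IsHyperhermitianForm

variable (h : IsHyperhermitianForm g J)
include h

lemma correction_comm (h₀ : ∀ n v, S₀ (J n v) = J n (S₀ v))
    (hS : ∀ m n v, S m (J n v) = J n (S m v)) (n : Fin 3) (u v : W) :
    correction g J X S₀ S l p t y u (J n v) = J n (correction g J X S₀ S l p t y u v) := by
  have pre : preCorrection g J X S₀ S l p t y u (J n v) =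
      J n (preCorrection g J X S₀ S l p t y u v) := by
    simp only [preCorrection, map_add, map_smul, h.quatRankOne_comm, h₀, hS]
  simp only [correction, pre, h.quatRankOne_comm, map_sub, map_smul]

lemma deformed_correction (hl : 1 + l * g X X ≠ 0) (φ : ℝ) (u v w : W) :
    deformedForm g J X φ (l * φ) w (correction g J X S₀ S l p t y u v) =
      φ * g w (preCorrection g J X S₀ S l p t y u v) := by
  simp only [deformedForm, correction, map_sub, map_smul, add_apply, smul_apply, smul_eq_mul,
    ContinuousLinearMap.comp_apply, ← h.apply_quatRankOne, h.quatRankOne_idem]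
  field_simp
  ring

/-- The algebraic form of `D' g' = 0`: the right hand side is the derivative of the deformed form
along `u`, divided by `φ`. -/
lemma preCorrection_metric (h₀ : ∀ v w, g (S₀ v) w = -g v (S₀ w))
    (hS : ∀ n v w, g (S n v) w = -g v (S n w)) (u v w : W) :
    g (preCorrection g J X S₀ S l p t y u v) w + g v (preCorrection g J X S₀ S l p t y u w) =
      2 * p * g X u * g v w + 2 * y * g X u * g (quatRankOne g J X X v) w +
      (p + t) * (g (quatRankOne g J X u v) w + g (quatRankOne g J u X v) w) := by
  have T := h.mul_table
  have s₁ : ∀ n, g (J n v) X = - g (J n X) v := fun n ↦ h.swap n v X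
  have s₂ : ∀ n, g (J n v) u = - g (J n u) v := fun n ↦ h.swap n v u
  simp only [preCorrection, map_add, map_smul, add_apply, smul_apply, smul_eq_mul,
    quatRankOne_apply, h₀, hS, map_neg, neg_apply, h.apply_right, s₁, s₂,
    (T _).1, (T _).2.1, (T _).2.2.1, (T _).2.2.2.1, (T _).2.2.2.2.1,
    (T _).2.2.2.2.2, h.sq, h.symm v w, h.symm v u, h.symm v X]
  ring

/-- The algebraic form of the skew-symmetry of the torsion of `D'`. -/
lemma preCorrection_torsion {T : W →L[ℝ] W →L[ℝ] W} {e : ℝ}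
    (hT : ∀ u v w, g u (T v w) = -g u (T w v) ∧ g u (T v w) = -g v (T u w))
    (h₀ : ∀ v, S₀ v = T X v) (hS : ∀ n v, S n v = T (J n X) v + e • J n v)
    (hpt : 2 * t + p = e * l) (u w : W) :
    g u (T u w) + l * g (quatRankOne g J X X u) (T u w) +
      g u (preCorrection g J X S₀ S l p t y u w - preCorrection g J X S₀ S l p t y w u) = 0 := by
  have hz : g u (T u w) = 0 := by linarith [(hT u u w).2]
  -- `g(z, T(u, w)) = g(u, T(w, z)) = - g(u, T(z, w))`
  have hc : ∀ z, g z (T u w) = -g u (T z w) := fun z ↦ (hT z u w).2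
  have hc' : ∀ z, g u (T z u) = 0 := fun z ↦ by
    linarith [(hT u z u).1, (hT u u z).2]
  have M := h.mul_table
  have s₁ : ∀ n, g (J n w) u = - g (J n u) w := fun n ↦ h.swap n w u
  have s₂ : ∀ n, g (J n u) X = - g (J n X) u := fun n ↦ h.swap n u X
  simp only [preCorrection, map_add, map_sub, map_smul, add_apply, smul_apply, smul_eq_mul,
    quatRankOne_apply, h₀, hS, map_neg, h.apply_right, s₁, s₂, hz, hc, hc', h.self,
    (M _).1, (M _).2.1, (M _).2.2.1, (M _).2.2.2.1, (M _).2.2.2.2.1,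
    (M _).2.2.2.2.2, h.sq, h.symm u w, h.symm u X]
  linear_combination (g (J 0 X) u * g (J 0 u) w + g (J 1 X) u * g (J 1 u) w
    + g (J 2 X) u * g (J 2 u) w) * hpt

end IsHyperhermitianForm

end ConnectionAlgebra

/-! ### Smoothness of sections of homomorphism bundles -/

section HomBundle

variable {E : Type*} [NormedAddCommGroup E] [NormedSpace ℝ E]
  {H : Type*} [TopologicalSpace H] {I : ModelWithCorners ℝ E H}
  {M : Type*} [TopologicalSpace M] [ChartedSpace H M] {k : ℕ∞ω} {x₀ : M}

lemma contMDiffAt_of_clm_apply {F₁ F₂ : Type*} [NormedAddCommGroup F₁] [NormedSpace ℝ F₁]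
    [FiniteDimensional ℝ F₁] [NormedAddCommGroup F₂] [NormedSpace ℝ F₂] {f : M → F₁ →L[ℝ] F₂}
    (hf : ∀ v, CMDiffAt k (fun x ↦ f x v) x₀) : CMDiffAt k f x₀ := by
  have hd : Module.finrank ℝ F₁ = Module.finrank ℝ (Fin (Module.finrank ℝ F₁) → ℝ) :=
    (Module.finrank_fin_fun ℝ).symm
  let e₁ := ContinuousLinearEquiv.ofFinrankEq hd
  let e₂ := (e₁.arrowCongr (1 : F₂ ≃L[ℝ] F₂)).trans
    (ContinuousLinearEquiv.piRing (Fin (Module.finrank ℝ F₁)))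
  rw [← Function.id_comp f, ← e₂.symm_comp_self]
  exact e₂.symm.contDiff.contMDiff.contMDiffAt.comp x₀
    (contMDiffAt_pi_space.mpr fun i ↦ hf (e₁.symm (Pi.single i 1)))

/-- The derivative of a function of one real variable composed with a function on `M`. -/
lemma mvfderiv_real_comp {F : ℝ → ℝ} {f : M → ℝ} {x : M} {F' : ℝ} (hF : HasDerivAt F F' (f x))
    (hf : MDiffAt f x) (u : TangentSpace I x) :
    mvfderiv I (fun m ↦ F (f m)) x u = F' * mvfderiv I f x u := by
  have h := hF.hasFDerivAt.hasMFDerivAt.comp x hf.hasMFDerivAt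
  change NormedSpace.fromTangentSpace _ (mfderiv I 𝓘(ℝ, ℝ) (F ∘ f) x u) =
    F' * NormedSpace.fromTangentSpace _ (mfderiv I 𝓘(ℝ, ℝ) f x u)
  rw [h.mfderiv, mul_comm]
  rfl

variable {F₁ : Type*} [NormedAddCommGroup F₁] [NormedSpace ℝ F₁] {E₁ : M → Type*}
  [∀ x, AddCommGroup (E₁ x)] [∀ x, Module ℝ (E₁ x)] [TopologicalSpace (TotalSpace F₁ E₁)]
  [∀ x, TopologicalSpace (E₁ x)] [FiberBundle F₁ E₁] [VectorBundle ℝ F₁ E₁]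
  {F₂ : Type*} [NormedAddCommGroup F₂] [NormedSpace ℝ F₂] {E₂ : M → Type*}
  [∀ x, AddCommGroup (E₂ x)] [∀ x, Module ℝ (E₂ x)] [TopologicalSpace (TotalSpace F₂ E₂)]
  [∀ x, TopologicalSpace (E₂ x)] [FiberBundle F₂ E₂] [VectorBundle ℝ F₂ E₂]
  [∀ x, IsTopologicalAddGroup (E₂ x)] [∀ x, ContinuousSMul ℝ (E₂ x)] [FiniteDimensional ℝ F₁]

/-- A section of `Hom(E₁, E₂)`, with `E₁` of finite rank, is smooth at a point if it takes sections
smooth at that point to sections smooth at that point. -/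
lemma contMDiffAt_hom_of_apply {Φ : ∀ x, E₁ x →L[ℝ] E₂ x}
    (hΦ : ∀ σ : ∀ x, E₁ x, CMDiffAt k (T% σ) x₀ → CMDiffAt k (T% (fun x ↦ Φ x (σ x))) x₀) :
    ContMDiffAt I (I.prod 𝓘(ℝ, F₁ →L[ℝ] F₂)) k
      (fun x ↦ TotalSpace.mk' (F₁ →L[ℝ] F₂) (E := fun x ↦ E₁ x →L[ℝ] E₂ x) x (Φ x)) x₀ := by
  rw [contMDiffAt_hom_bundle]
  refine ⟨contMDiffAt_id, contMDiffAt_of_clm_apply fun w ↦ ?_⟩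
  -- test on the local section that is constantly `w` in the trivialization
  have h := hΦ (FiberBundle.extend F₁ ((trivializationAt F₁ E₁ x₀).symm x₀ w))
    (FiberBundle.contMDiffAt_extend I F₁ _)
  rw [contMDiffAt_section] at h
  refine h.congr_of_eventuallyEq ?_
  filter_upwards [(trivializationAt F₁ E₁ x₀).open_baseSet.mem_nhds
      (FiberBundle.mem_baseSet_trivializationAt' x₀),
    (trivializationAt F₂ E₂ x₀).open_baseSet.mem_nhds
      (FiberBundle.mem_baseSet_trivializationAt' x₀)] with x hx₁ hx₂
  have h₀ : x₀ ∈ (trivializationAt F₁ E₁ x₀).baseSet :=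
    FiberBundle.mem_baseSet_trivializationAt' x₀
  simp [ContinuousLinearMap.inCoordinates, FiberBundle.extend, hx₁, hx₂, h₀,
    Trivialization.symmL_apply, Trivialization.coe_linearMapAt_of_mem]

lemma contMDiffAt_trivial_iff {f : M → ℝ} :
    ContMDiffAt I (I.prod 𝓘(ℝ, ℝ)) k
      (fun m ↦ TotalSpace.mk' ℝ (E := Bundle.Trivial M ℝ) m (f m)) x₀ ↔ CMDiffAt k f x₀ :=
  ⟨fun h ↦ (contMDiffAt_totalSpace.1 h).2, fun h ↦ contMDiffAt_totalSpace.2 ⟨contMDiffAt_id, h⟩⟩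

end HomBundle

section Calculus

variable {E : Type*} [NormedAddCommGroup E] [NormedSpace ℝ E]
  {H : Type*} [TopologicalSpace H] {I : ModelWithCorners ℝ E H}
  {M : Type*} [TopologicalSpace M] [ChartedSpace H M] [IsManifold I ∞ M]
  {g : BilinField I M} {A : EndField I M} {V W : VField I M} {x : M}

lemma BilinField.Smooth.contMDiffAt_app (hg : g.Smooth)
    (hV : CMDiffAt ∞ (T% V) x) (hW : CMDiffAt ∞ (T% W) x) : CMDiffAt ∞ (g.app V W) x := by
  have : ContMDiffAt I (I.prod 𝓘(ℝ, ℝ)) ∞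
      (fun m ↦ TotalSpace.mk' ℝ (E := Bundle.Trivial M ℝ) m (g m (V m) (W m))) x :=
    ContMDiffAt.clm_bundle_apply₂ (F₁ := E) (F₂ := E) (hg x) hV hW
  exact contMDiffAt_trivial_iff.1 this

lemma BilinField.Smooth.mdifferentiableAt_app (hg : g.Smooth)
    (hV : MDiffAt (T% V) x) (hW : MDiffAt (T% W) x) : MDiffAt (g.app V W) x := by
  have : MDifferentiableAt I (I.prod 𝓘(ℝ, ℝ))
      (fun m ↦ TotalSpace.mk' ℝ (E := Bundle.Trivial M ℝ) m (g m (V m) (W m))) x :=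
    MDifferentiableAt.clm_bundle_apply₂ (F₁ := E) (F₂ := E)
      ((hg x).mdifferentiableAt (by simp)) hV hW
  simp only [mdifferentiableAt_totalSpace] at this
  exact this.2

lemma EndField.Smooth.contMDiffAt_app (hA : A.Smooth) (hV : CMDiffAt ∞ (T% V) x) :
    CMDiffAt ∞ (T% (A.app V)) x :=
  ContMDiffAt.clm_bundle_apply (F₁ := E) (F₂ := E) (hA x) hV

lemma EndField.Smooth.mdifferentiableAt_app (hA : A.Smooth) (hV : MDiffAt (T% V) x) :
    MDiffAt (T% (A.app V)) x :=
  MDifferentiableAt.clm_bundle_apply (F₁ := E) (F₂ := E) ((hA x).mdifferentiableAt (by simp)) hV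

lemma BilinField.smooth_of_apply [FiniteDimensional ℝ E]
    (h : ∀ (x : M) (V W : VField I M), CMDiffAt ∞ (T% V) x → CMDiffAt ∞ (T% W) x →
      CMDiffAt ∞ (g.app V W) x) : g.Smooth := by
  intro x
  refine contMDiffAt_hom_of_apply (E₁ := fun x : M ↦ TangentSpace I x)
    (E₂ := fun x : M ↦ TangentSpace I x →L[ℝ] Bundle.Trivial M ℝ x) fun V hV ↦ ?_
  refine contMDiffAt_hom_of_apply (E₁ := fun x : M ↦ TangentSpace I x)
    (E₂ := Bundle.Trivial M ℝ) fun W hW ↦ ?_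
  exact contMDiffAt_trivial_iff.2 (h x V W hV hW)

lemma contMDiffAt_mlieBracket [CompleteSpace E] (hV : CMDiff ∞ (T% V)) (hW : CMDiff ∞ (T% W)) :
    CMDiffAt ∞ (T% (mlieBracket I V W)) x := by
  have : IsManifold I (((⊤ : ℕ∞) : ℕ∞ω) + 1) M := inferInstanceAs (IsManifold I ∞ M)
  have : IsManifold I (minSmoothness ℝ 2) M := by
    rw [minSmoothness_of_isRCLikeNormedField]
    infer_instance
  exact ContMDiffAt.mlieBracket_vectorField (m := ⊤) (n := ⊤) (hV x) (hW x) (by simp)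

end Calculus

/-! ### Consequences of a special homothety -/

section SpecialHomothety

@[simp]
lemma EndField.app_apply {E : Type*} [NormedAddCommGroup E] [NormedSpace ℝ E]
    {H : Type*} [TopologicalSpace H] {I : ModelWithCorners ℝ E H}
    {M : Type*} [TopologicalSpace M] [ChartedSpace H M]
    (A : EndField I M) (V : VField I M) (x : M) : A.app V x = A x (V x) := rfl

@[simp]
lemma BilinField.app_apply {E : Type*} [NormedAddCommGroup E] [NormedSpace ℝ E]
    {H : Type*} [TopologicalSpace H] {I : ModelWithCorners ℝ E H}
    {M : Type*} [TopologicalSpace M] [ChartedSpace H M]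
    (g : BilinField I M) (V W : VField I M) (x : M) :
    g.app V W x = g x (V x) (W x) := rfl

variable {E : Type*} [NormedAddCommGroup E] [NormedSpace ℝ E]
  {H : Type*} [TopologicalSpace H] {I : ModelWithCorners ℝ E H}
  {M : Type*} [TopologicalSpace M] [ChartedSpace H M] [IsManifold I ∞ M]
  {Q : Hypercomplex I M} {g : BilinField I M} {X V W : VField I M} {a b : ℝ} {x : M}

lemma IsHyperhermitian.formAt (hg : IsHyperhermitian Q g) (x : M) :
    IsHyperhermitianForm (g x) (fun n ↦ Q.J n x) :=
  ⟨fun n ↦ Q.sq n x, fun n ↦ Q.mul n x, hg.symm x, fun n ↦ hg.hermitian n x⟩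

/-- The torsion of an HKT connection, contracted with a vector, is a skew endomorphism. -/
lemma IsHKTConnection.torsion_skew [FiniteDimensional ℝ E] [CompleteSpace E]
    {D : CovariantDerivative I E (TangentSpace I : M → Type _)} (hg : IsHyperhermitian Q g)
    (hD : IsHKTConnection Q g D) (x : M) (z v w : TangentSpace I x) :
    g x (D.torsion x z v) w = -g x v (D.torsion x z w) := by
  have e1 := (hD.skew x w z v).2
  have e2 := (hD.skew x z w v).1
  have e3 := (hD.skew x z v w).2
  have e4 := hg.symm x (D.torsion x z v) w
  linarith

lemma fin_three_cases (m n : Fin 3) : n = m ∨ n = m + 1 ∨ n = m + 2 := by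
  revert m n
  decide

namespace IsSpecialHomothety

variable (hX : IsSpecialHomothety Q g X a b)
include hX

lemma mdifferentiableAt (x : M) : MDiffAt (T% X) x := (hX.smooth x).mdifferentiableAt (by simp)

lemma mdifferentiableAt_app (n : Fin 3) (x : M) : MDiffAt (T% ((Q.J n).app X)) x :=
  (Q.smooth n).mdifferentiableAt_app (hX.mdifferentiableAt x)

lemma bracket_J_self (n : Fin 3) (hV : MDiffAt (T% V) x) :
    mlieBracket I ((Q.J n).app X) ((Q.J n).app V) x =
      Q.J n x (mlieBracket I ((Q.J n).app X) V x) := by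
  have := hX.holomorphic n V x hV
  simp only [lieDerivEnd, zero_apply] at this
  exact sub_eq_zero.1 this

lemma bracket_J_add_one (n : Fin 3) (hV : MDiffAt (T% V) x) :
    mlieBracket I ((Q.J n).app X) ((Q.J (n + 1)).app V) x =
      Q.J (n + 1) x (mlieBracket I ((Q.J n).app X) V x) + b • Q.J (n + 2) x (V x) := by
  have := hX.rotation n V x hV
  simp only [lieDerivEnd, smul_apply] at this
  rw [← this]
  abel

lemma bracket_J_add_two (n : Fin 3) (hV : MDiffAt (T% V) x) :
    mlieBracket I ((Q.J n).app X) ((Q.J (n + 2)).app V) x =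
      Q.J (n + 2) x (mlieBracket I ((Q.J n).app X) V x) - b • Q.J (n + 1) x (V x) := by
  have e : (Q.J (n + 2)).app V = (Q.J n).app ((Q.J (n + 1)).app V) :=
    funext fun y ↦ (Q.mul n y (V y)).symm
  rw [e, hX.bracket_J_self n ((Q.smooth (n + 1)).mdifferentiableAt_app hV),
    hX.bracket_J_add_one n hV, map_add, map_smul, Q.mul, ← Q.mul n x (V x), Q.sq]
  module

lemma bracket_J_X (n : Fin 3) (x : M) : mlieBracket I ((Q.J n).app X) X x = 0 := by
  have h := hX.bracket_J_self n (hX.mdifferentiableAt x)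
  rw [mlieBracket_self, Pi.zero_apply] at h
  have h2 := congrArg (Q.J n x) h
  rw [Q.sq, map_zero] at h2
  exact neg_eq_zero.1 h2.symm

/-- `X` preserves the complex structures. By the vanishing of the Nijenhuis tensor this follows
from `L_{IX} I = 0` and its cyclic permutations. -/
lemma bracket_X_J (n : Fin 3) (hV : MDiffAt (T% V) x) :
    mlieBracket I X ((Q.J n).app V) x = Q.J n x (mlieBracket I X V x) := by
  have h := Q.integrable n X V x (hX.mdifferentiableAt x) hV
  rw [hX.bracket_J_self n hV, sub_self, zero_sub, sub_eq_zero, neg_eq_iff_eq_neg] at h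
  have h2 := congrArg (Q.J n x) h
  rw [Q.sq, map_neg] at h2
  exact neg_injective h2

lemma bracket_frame (n : Fin 3) (x : M) :
    mlieBracket I ((Q.J n).app X) ((Q.J n).app X) x = 0 ∧
    mlieBracket I ((Q.J n).app X) ((Q.J (n + 1)).app X) x = b • Q.J (n + 2) x (X x) ∧
    mlieBracket I ((Q.J n).app X) ((Q.J (n + 2)).app X) x = -(b • Q.J (n + 1) x (X x)) := by
  have hx := hX.mdifferentiableAt x
  refine ⟨by rw [mlieBracket_self]; rfl, ?_, ?_⟩
  · rw [hX.bracket_J_add_one n hx, hX.bracket_J_X, map_zero, zero_add]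
  · rw [hX.bracket_J_add_two n hx, hX.bracket_J_X, map_zero, zero_sub]

variable [FiniteDimensional ℝ E] [CompleteSpace E]
  {D : CovariantDerivative I E (TangentSpace I : M → Type _)}

/-- The HKT connection of `g` satisfies `D_u X = (a / 2) u`: since the torsion is skew, the Lie
derivatives of `g` along `X` and `J_n X` are the symmetrizations of `D X` and `J_n D X`. -/
lemma cov_X (hg : IsHyperhermitian Q g) (hD : IsHKTConnection Q g D) (x : M)
    (u : TangentSpace I x) : D X x u = (a / 2) • u := by
  -- Lie derivatives in terms of `D`: `D_Y V - [Y, V] = D_V Y + T(Y, V)`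
  have key : ∀ (Y : VField I M) (s : ℝ), MDiffAt (T% Y) x →
      LieBilinEq Y g (fun x ↦ s • g x) → ∀ v w : TangentSpace I x,
      g x (D Y x v) w + g x v (D Y x w) = s * g x v w := by
    intro Y s hY hL v w
    have hv := FiberBundle.mdifferentiableAt_extend I E v
    have hw := FiberBundle.mdifferentiableAt_extend I E w
    have h1 := hL (FiberBundle.extend E v) (FiberBundle.extend E w) x hv hw
    rw [lieDerivBilin, hD.metric _ _ x (Y x) hv hw] at h1
    have tv := D.torsion_apply hY hv
    have tw := D.torsion_apply hY hw
    simp only [FiberBundle.extend_apply_self] at h1 tv tw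
    have h2 := hD.torsion_skew hg x (Y x) v w
    rw [tv, tw] at h2
    simp only [map_sub, sub_apply, smul_apply, smul_eq_mul] at h1 h2
    linarith
  refine (hg.formAt x).eq_half_smul (hg.nondegenerate x)
    (key X a (hX.mdifferentiableAt x) hX.homothety) (fun n v w ↦ ?_) u
  have h0 : LieBilinEq ((Q.J n).app X) g (fun x ↦ (0 : ℝ) • g x) := fun V W y hV hW ↦ by
    rw [hX.isometry n V W y hV hW]
    exact (zero_mul (g y (V y) (W y))).symm
  have := key _ 0 (hX.mdifferentiableAt_app n x) h0 v w
  rwa [hD.complex n X x v (hX.mdifferentiableAt x), hD.complex n X x w (hX.mdifferentiableAt x),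
    zero_mul] at this

variable (hg : IsHyperhermitian Q g) (hD : IsHKTConnection Q g D)
include hg hD

lemma cov_J_X (n : Fin 3) (x : M) (u : TangentSpace I x) :
    D ((Q.J n).app X) x u = (a / 2) • Q.J n x u := by
  rw [hD.complex n X x u (hX.mdifferentiableAt x), hX.cov_X hg hD, map_smul]

lemma torsion_X (hV : MDiffAt (T% V) x) :
    D.torsion x (X x) (V x) = D V x (X x) - (a / 2) • V x - mlieBracket I X V x := by
  rw [D.torsion_apply (hX.mdifferentiableAt x) hV, hX.cov_X hg hD]

lemma torsion_J_X (n : Fin 3) (hV : MDiffAt (T% V) x) :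
    D.torsion x (Q.J n x (X x)) (V x) = D V x (Q.J n x (X x)) - (a / 2) • Q.J n x (V x) -
      mlieBracket I ((Q.J n).app X) V x := by
  have := D.torsion_apply (hX.mdifferentiableAt_app n x) hV
  rwa [hX.cov_J_X hg hD] at this

lemma torsion_X_comm (n : Fin 3) (x : M) (v : TangentSpace I x) :
    D.torsion x (X x) (Q.J n x v) = Q.J n x (D.torsion x (X x) v) := by
  have hv := FiberBundle.mdifferentiableAt_extend I E v
  have h1 := hX.torsion_X hg hD hv
  have h2 := hX.torsion_X hg hD ((Q.smooth n).mdifferentiableAt_app hv)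
  rw [hX.bracket_X_J n hv, hD.complex n _ x _ hv] at h2
  simp only [FiberBundle.extend_apply_self, EndField.app_apply] at h1 h2
  rw [h1, h2]
  simp only [map_sub, map_smul]

/-- Contracting the torsion of `D` with `J X` gives `-(a + b) / 2 J` up to an endomorphism
commuting with `I`, `J` and `K`. -/
lemma torsion_J_X_comm (m n : Fin 3) (x : M) (v : TangentSpace I x) :
    D.torsion x (Q.J m x (X x)) (Q.J n x v) + ((a + b) / 2) • Q.J m x (Q.J n x v) =
      Q.J n x (D.torsion x (Q.J m x (X x)) v + ((a + b) / 2) • Q.J m x v) := by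
  have h := hg.formAt x
  have hv := FiberBundle.mdifferentiableAt_extend I E v
  have h1 := hX.torsion_J_X hg hD m hv
  have h2 := hX.torsion_J_X hg hD m ((Q.smooth n).mdifferentiableAt_app hv)
  rw [hD.complex n _ x _ hv] at h2
  simp only [FiberBundle.extend_apply_self, EndField.app_apply] at h1 h2
  rw [h1, h2]
  rcases fin_three_cases m n with rfl | rfl | rfl
  · rw [hX.bracket_J_self _ hv]
    simp only [map_sub, map_smul, map_add]
  · rw [hX.bracket_J_add_one _ hv]
    have e1 := h.mul m v
    have e2 := h.mul_rev m v
    simp only [map_sub, map_smul, map_add, e1, e2, FiberBundle.extend_apply_self]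
    module
  · rw [hX.bracket_J_add_two _ hv]
    have e1 := h.mul_two m v
    have e2 : Q.J (m + 2) x (Q.J m x v) = Q.J (m + 1) x v := by
      have := h.mul (m + 2) v
      have i1 : m + 2 + 1 = m := by fin_cases m <;> rfl
      have i2 : m + 2 + 2 = m + 1 := by fin_cases m <;> rfl
      rwa [i1, i2] at this
    simp only [map_sub, map_smul, map_add, e1, e2, FiberBundle.extend_apply_self]
    module

end IsSpecialHomothety

end SpecialHomothety

/-! ### The deformed metric -/

section Deformation

lemma hasDerivAt_sq_rpow (κ : ℝ) {t : ℝ} (ht : t ≠ 0) :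
    HasDerivAt (fun t : ℝ ↦ (t ^ 2) ^ (κ / 2)) (κ * (t ^ 2) ^ (κ / 2) / t) t := by
  have h := (hasDerivAt_pow 2 t).rpow_const (p := κ / 2) (Or.inl (pow_ne_zero 2 ht))
  convert h using 1
  rw [Real.rpow_sub_one (pow_ne_zero 2 ht)]
  push_cast
  field_simp

lemma hasDerivAt_sq_rpow_mul_div (κ c : ℝ) {t : ℝ} (ht : t ≠ 0) :
    HasDerivAt (fun t : ℝ ↦ (t ^ 2) ^ (κ / 2) * c / t)
      ((κ - 1) * ((t ^ 2) ^ (κ / 2) * c / t) / t) t := by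
  have h := ((hasDerivAt_sq_rpow κ ht).mul_const c).div (hasDerivAt_id t) ht
  refine h.congr_deriv ?_
  simp only [id]
  field_simp

variable {E : Type*} [NormedAddCommGroup E] [NormedSpace ℝ E]
  {H : Type*} [TopologicalSpace H] {I : ModelWithCorners ℝ E H}
  {M : Type*} [TopologicalSpace M] [ChartedSpace H M]
  {g : BilinField I M} {X V W : VField I M} {a b κ c : ℝ} {x : M}

/-- A definite metric takes non-zero values on a nowhere zero vector field. -/
lemma IsDefinite.app_ne_zero (hdef : IsDefinite g) (hX : ∀ x, X x ≠ 0) (x : M) :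
    g.app X X x ≠ 0 := by
  rcases hdef with h | h
  · exact (h x _ (hX x)).ne'
  · exact (h x _ (hX x)).ne

lemma IsDefinite.nondegenerate (hdef : IsDefinite g) (x : M) (u : TangentSpace I x)
    (hu : ∀ v, g x u v = 0) : u = 0 := by
  by_contra h0
  rcases hdef with h | h
  · exact (h x u h0).ne' (hu u)
  · exact (h x u h0).ne (hu u)

variable [IsManifold I ∞ M] {Q : Hypercomplex I M}

/-- The metric `|g(X, X)| ^ κ (g + c g(X, X)⁻¹ (θ₀² + θ₁² + θ₂² + θ₃²))`, where `θ₀, …, θ₃` are dual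
under `g` to `X`, `I X`, `J X` and `K X`. Writing `|r| ^ κ` as `(r ^ 2) ^ (κ / 2)` makes it visibly
smooth in `r ≠ 0` of either sign. -/
def deformedMetric (Q : Hypercomplex I M) (g : BilinField I M) (X : VField I M) (κ c : ℝ) :
    BilinField I M := fun x ↦
  deformedForm (g x) (fun n ↦ Q.J n x) (X x) ((g.app X X x ^ 2) ^ (κ / 2))
    ((g.app X X x ^ 2) ^ (κ / 2) * c / g.app X X x)

lemma deformedMetric_app (V W : VField I M) : (deformedMetric Q g X κ c).app V W =
    (fun x ↦ (g.app X X x ^ 2) ^ (κ / 2)) * g.app V W +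
    (fun x ↦ (g.app X X x ^ 2) ^ (κ / 2) * c / g.app X X x) * (g.app X V * g.app X W +
      (g.app ((Q.J 0).app X) V * g.app ((Q.J 0).app X) W +
       g.app ((Q.J 1).app X) V * g.app ((Q.J 1).app X) W +
       g.app ((Q.J 2).app X) V * g.app ((Q.J 2).app X) W)) :=
  funext fun x ↦ deformedForm_apply (X x) (V x) (W x) _ _

lemma deformedMetric_apply (x : M) (v w : TangentSpace I x) : deformedMetric Q g X κ c x v w =
    (g.app X X x ^ 2) ^ (κ / 2) * g x v w +
    (g.app X X x ^ 2) ^ (κ / 2) * c / g.app X X x * (g x (X x) v * g x (X x) w +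
      (g x (Q.J 0 x (X x)) v * g x (Q.J 0 x (X x)) w +
       g x (Q.J 1 x (X x)) v * g x (Q.J 1 x (X x)) w +
       g x (Q.J 2 x (X x)) v * g x (Q.J 2 x (X x)) w)) :=
  deformedForm_apply (X x) v w _ _

/-- The derivative of `g'(V, W)` for the deformed metric `g'`, in terms of the derivatives of
`g(X, X)`, `g(V, W)`, `θᵢ(V)` and `θᵢ(W)`. -/
lemma mvfderiv_deformedMetric (hg : IsHyperhermitian Q g) (hX : MDiffAt (T% X) x)
    (hr : g.app X X x ≠ 0) (hV : MDiffAt (T% V) x) (hW : MDiffAt (T% W) x)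
    (u : TangentSpace I x) {ρ δ α₀ β₀ : ℝ} {α β : Fin 3 → ℝ}
    (hρ : mvfderiv I (g.app X X) x u = ρ * g.app X X x)
    (hδ : mvfderiv I (g.app V W) x u = δ)
    (hα₀ : mvfderiv I (g.app X V) x u = α₀) (hβ₀ : mvfderiv I (g.app X W) x u = β₀)
    (hα : ∀ n, mvfderiv I (g.app ((Q.J n).app X) V) x u = α n)
    (hβ : ∀ n, mvfderiv I (g.app ((Q.J n).app X) W) x u = β n) :
    mvfderiv I ((deformedMetric Q g X κ c).app V W) x u =
      (g.app X X x ^ 2) ^ (κ / 2) * (κ * ρ * g.app V W x + δ) +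
      (g.app X X x ^ 2) ^ (κ / 2) * c / g.app X X x * ((κ - 1) * ρ *
        (g.app X V x * g.app X W x +
        (g.app ((Q.J 0).app X) V x * g.app ((Q.J 0).app X) W x +
         g.app ((Q.J 1).app X) V x * g.app ((Q.J 1).app X) W x +
         g.app ((Q.J 2).app X) V x * g.app ((Q.J 2).app X) W x)) +
        (α₀ * g.app X W x + g.app X V x * β₀ +
        (α 0 * g.app ((Q.J 0).app X) W x + g.app ((Q.J 0).app X) V x * β 0 +
         (α 1 * g.app ((Q.J 1).app X) W x + g.app ((Q.J 1).app X) V x * β 1) +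
         (α 2 * g.app ((Q.J 2).app X) W x + g.app ((Q.J 2).app X) V x * β 2)))) := by
  have hJ : ∀ n, MDiffAt (T% ((Q.J n).app X)) x := fun n ↦ (Q.smooth n).mdifferentiableAt_app hX
  have d : ∀ {Y Z : VField I M}, MDiffAt (T% Y) x → MDiffAt (T% Z) x → MDiffAt (g.app Y Z) x :=
    fun hY hZ ↦ hg.smooth.mdifferentiableAt_app hY hZ
  have dr := d hX hX
  have dφ : MDiffAt (fun x ↦ (g.app X X x ^ 2) ^ (κ / 2)) x :=
    (hasDerivAt_sq_rpow κ hr).differentiableAt.mdifferentiableAt.comp x dr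
  have dψ : MDiffAt (fun x ↦ (g.app X X x ^ 2) ^ (κ / 2) * c / g.app X X x) x :=
    (hasDerivAt_sq_rpow_mul_div κ c hr).differentiableAt.mdifferentiableAt.comp x dr
  have m : ∀ n, MDiffAt (g.app ((Q.J n).app X) V * g.app ((Q.J n).app X) W) x :=
    fun n ↦ (d (hJ n) hV).mul (d (hJ n) hW)
  have m₀ : MDiffAt (g.app X V * g.app X W) x := (d hX hV).mul (d hX hW)
  have e : ∀ n, mvfderiv I (g.app ((Q.J n).app X) V * g.app ((Q.J n).app X) W) x u =
      α n * g.app ((Q.J n).app X) W x + g.app ((Q.J n).app X) V x * β n := fun n ↦ by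
    rw [mvfderiv_mul (d (hJ n) hV) (d (hJ n) hW), add_apply, smul_apply, smul_apply, hα, hβ]
    simp only [smul_eq_mul]
    ring
  rw [deformedMetric_app, mvfderiv_add (dφ.mul (d hV hW))
    (dψ.mul (m₀.add (((m 0).add (m 1)).add (m 2)))), mvfderiv_mul dφ (d hV hW),
    mvfderiv_mul dψ (m₀.add (((m 0).add (m 1)).add (m 2))),
    mvfderiv_add m₀ (((m 0).add (m 1)).add (m 2)),
    mvfderiv_add ((m 0).add (m 1)) (m 2), mvfderiv_add (m 0) (m 1),
    mvfderiv_mul (d hX hV) (d hX hW)]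
  simp only [add_apply, smul_apply, smul_eq_mul, e, hδ, hα₀, hβ₀, Pi.add_apply, Pi.mul_apply]
  rw [mvfderiv_real_comp (hasDerivAt_sq_rpow κ hr) dr,
    mvfderiv_real_comp (hasDerivAt_sq_rpow_mul_div κ c hr) dr, hρ]
  field_simp
  ring

lemma isDefinite_deformedMetric (hg : IsHyperhermitian Q g) (hdef : IsDefinite g)
    (hX : ∀ x, X x ≠ 0) (hc : 0 < 1 + c) : IsDefinite (deformedMetric Q g X κ c) := by
  have hφ : ∀ x, 0 < (g.app X X x ^ 2) ^ (κ / 2) := fun x ↦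
    Real.rpow_pos_of_pos (sq_pos_of_ne_zero (hdef.app_ne_zero hX x)) _
  rcases hdef with h | h
  · refine Or.inl fun x v hv ↦ ?_
    have := (hg.formAt x).deformed_pos (ε := 1) (fun v hv ↦ by simpa using h x v hv) (hX x)
      (hφ x) hc hv
    rwa [one_mul] at this
  · refine Or.inr fun x v hv ↦ ?_
    have := (hg.formAt x).deformed_pos (ε := -1) (fun v hv ↦ by simpa using h x v hv) (hX x)
      (hφ x) hc hv
    rw [neg_one_mul] at this
    exact neg_pos.1 this

lemma isHyperhermitian_deformedMetric [FiniteDimensional ℝ E] (hg : IsHyperhermitian Q g)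
    (hdef : IsDefinite g) (hXs : CMDiff ∞ (T% X)) (hX : ∀ x, X x ≠ 0) (hc : 0 < 1 + c) :
    IsHyperhermitian Q (deformedMetric Q g X κ c) where
  smooth := by
    refine BilinField.smooth_of_apply fun x V W hV hW ↦ ?_
    rw [deformedMetric_app]
    have hr := hdef.app_ne_zero hX x
    have d : ∀ {Y Z : VField I M}, CMDiffAt ∞ (T% Y) x → CMDiffAt ∞ (T% Z) x →
        CMDiffAt ∞ (g.app Y Z) x := fun hY hZ ↦ hg.smooth.contMDiffAt_app hY hZ
    have dr := d (hXs x) (hXs x)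
    have hJ : ∀ n, CMDiffAt ∞ (T% ((Q.J n).app X)) x := fun n ↦
      (Q.smooth n).contMDiffAt_app (hXs x)
    have dφ : CMDiffAt ∞ (fun x ↦ (g.app X X x ^ 2) ^ (κ / 2)) x := by
      have : ContDiffAt ℝ ∞ (fun t : ℝ ↦ (t ^ 2) ^ (κ / 2)) (g.app X X x) :=
        (contDiffAt_id.pow 2).rpow_const_of_ne (pow_ne_zero 2 hr)
      exact this.contMDiffAt.comp x dr
    have dψ : CMDiffAt ∞ (fun x ↦ (g.app X X x ^ 2) ^ (κ / 2) * c / g.app X X x) x :=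
      (dφ.mul contMDiffAt_const).div₀ dr hr
    exact (dφ.mul (d hV hW)).add (dψ.mul (((d (hXs x) hV).mul (d (hXs x) hW)).add
      ((((d (hJ 0) hV).mul (d (hJ 0) hW)).add ((d (hJ 1) hV).mul (d (hJ 1) hW))).add
        ((d (hJ 2) hV).mul (d (hJ 2) hW)))))
  symm x u v := (hg.formAt x).deformed_symm _ _ _ _ _
  nondegenerate := (isDefinite_deformedMetric hg hdef hX hc).nondegenerate
  hermitian n x u v := (hg.formAt x).deformed_hermitian _ _ _ _ _ _

end Deformation

section DeformedHomothety

variable {E : Type*} [NormedAddCommGroup E] [NormedSpace ℝ E]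
  {H : Type*} [TopologicalSpace H] {I : ModelWithCorners ℝ E H}
  {M : Type*} [TopologicalSpace M] [ChartedSpace H M] [IsManifold I ∞ M]
  {Q : Hypercomplex I M} {g : BilinField I M} {X : VField I M} {a b κ c : ℝ}

lemma LieBilinEq.mvfderiv_app {Y V W : VField I M} {h : BilinField I M} {x : M}
    (hY : LieBilinEq Y g h) (hV : MDiffAt (T% V) x) (hW : MDiffAt (T% W) x) :
    mvfderiv I (g.app V W) x (Y x) = h x (V x) (W x) + g x (mlieBracket I Y V x) (W x) +
      g x (V x) (mlieBracket I Y W x) := by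
  have := hY V W x hV hW
  rw [lieDerivBilin] at this
  linarith

/-- `X` remains a special homothety for the deformed metric: `g(X, X)` has weight `a` under `X`,
and the one-forms `θ₀, …, θ₃` are rotated by `I X`, `J X` and `K X`. -/
lemma IsSpecialHomothety.deformedMetric (hX : IsSpecialHomothety Q g X a b)
    (hg : IsHyperhermitian Q g) (hr : ∀ x, g.app X X x ≠ 0) (κ c : ℝ) :
    IsSpecialHomothety Q (deformedMetric Q g X κ c) X ((κ + 1) * a) b where
  smooth := hX.smooth
  homothety V W x hV hW := by
    have hx := hX.mdifferentiableAt x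
    have hJ := fun n ↦ hX.mdifferentiableAt_app n x
    have bX : ∀ n, mlieBracket I X ((Q.J n).app X) x = 0 := fun n ↦ by
      rw [mlieBracket_swap_apply, hX.bracket_J_X, neg_zero]
    have b₀ : mlieBracket I X X x = 0 := by rw [mlieBracket_self]; rfl
    have hL := fun {V W : VField I M} ↦ hX.homothety.mvfderiv_app (x := x) (V := V) (W := W)
    rw [lieDerivBilin, mvfderiv_deformedMetric hg hx (hr x) hV hW (X x) (ρ := a)
      (by rw [hL hx hx, b₀]; simp) (hL hV hW) (hL hx hV) (hL hx hW)
      (fun n ↦ hL (hJ n) hV) (fun n ↦ hL (hJ n) hW)]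
    simp only [deformedMetric_apply, bX, b₀, map_zero, zero_apply, smul_apply, smul_eq_mul,
      BilinField.app_apply, EndField.app_apply]
    ring
  isometry n V W x hV hW := by
    have hx := hX.mdifferentiableAt x
    have hJ := fun n ↦ hX.mdifferentiableAt_app n x
    have bX := hX.bracket_J_X n x
    have hL := fun {V W : VField I M} ↦ (hX.isometry n).mvfderiv_app (x := x) (V := V) (W := W)
    rw [lieDerivBilin, mvfderiv_deformedMetric hg hx (hr x) hV hW ((Q.J n).app X x) (ρ := 0)
      (by rw [hL hx hx, bX]; simp) (hL hV hW) (hL hx hV) (hL hx hW)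
      (fun n ↦ hL (hJ n) hV) (fun n ↦ hL (hJ n) hW)]
    obtain ⟨f₀, f₁, f₂⟩ := hX.bracket_frame n x
    have hn : n = 0 ∨ n = 1 ∨ n = 2 := fin_three_cases 0 n
    rcases hn with rfl | rfl | rfl <;>
    · simp only [zero_add, Fin.reduceAdd] at f₁ f₂
      simp only [deformedMetric_apply, bX, f₀, f₁, f₂, map_zero, map_neg, map_smul, zero_apply,
        neg_apply, smul_apply, smul_eq_mul, BilinField.app_apply, EndField.app_apply]
      ring
  holomorphic := hX.holomorphic
  rotation := hX.rotation

end DeformedHomothety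

/-! ### The HKT connection of the deformed metric -/

section DeformedConnection

variable {E : Type*} [NormedAddCommGroup E] [NormedSpace ℝ E]
  {H : Type*} [TopologicalSpace H] {I : ModelWithCorners ℝ E H}
  {M : Type*} [TopologicalSpace M] [ChartedSpace H M] [IsManifold I ∞ M]
  [FiniteDimensional ℝ E] [CompleteSpace E]

/-- The difference tensor of the HKT connections of the deformed metric and of `g`, as a function
of the vector at which it is evaluated and of the direction of differentiation, in this order.
With `l = c / r`, preservation of the metric requires `p + t = a l / 2`, and skewness of the torsion
requires `p + 2 t = (a + b) l / 2`; the value of `y` comes from differentiating `c |r| ^ κ / r`. -/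
def correctionField (Q : Hypercomplex I M) (g : BilinField I M)
    (D : CovariantDerivative I E (TangentSpace I : M → Type _)) (X : VField I M) (a b κ c : ℝ)
    (x : M) : TangentSpace I x →L[ℝ] TangentSpace I x →L[ℝ] TangentSpace I x :=
  have : FiniteDimensional ℝ (TangentSpace I x) := inferInstanceAs (FiniteDimensional ℝ E)
  have : T2Space (TangentSpace I x) := inferInstanceAs (T2Space E)
  (isBilinearMap_correction (g := g x) (J := fun n ↦ Q.J n x) (X := X x)
    (l := c / g.app X X x) (p := (a - b) / 2 * (c / g.app X X x))
    (t := b / 2 * (c / g.app X X x))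
    (y := c / g.app X X x * (a * (κ - 1) / (2 * g.app X X x)))
    (D.torsion x (X x))
    (fun n ↦ D.torsion x (Q.J n x (X x)) + ((a + b) / 2) • Q.J n x)).toContinuousBilinearMap

variable {Q : Hypercomplex I M} {g : BilinField I M}
  {D : CovariantDerivative I E (TangentSpace I : M → Type _)} {X : VField I M} {a b κ c : ℝ}

lemma correctionField_apply (x : M) (u v : TangentSpace I x) :
    correctionField Q g D X a b κ c x v u =
      correction (g x) (fun n ↦ Q.J n x) (X x) (D.torsion x (X x))
        (fun n v ↦ D.torsion x (Q.J n x (X x)) v + ((a + b) / 2) • Q.J n x v)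
        (c / g.app X X x) ((a - b) / 2 * (c / g.app X X x)) (b / 2 * (c / g.app X X x))
        (c / g.app X X x * (a * (κ - 1) / (2 * g.app X X x))) u v := rfl

omit [FiniteDimensional ℝ E] [CompleteSpace E] in
lemma contMDiffAt_quatRankOne (hg : g.Smooth) {Z q V : VField I M} {x : M}
    (hZ : CMDiffAt ∞ (T% Z) x) (hq : CMDiffAt ∞ (T% q) x) (hV : CMDiffAt ∞ (T% V) x) :
    CMDiffAt ∞ (T% fun x ↦ quatRankOne (g x) (fun n ↦ Q.J n x) (Z x) (q x) (V x)) x := by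
  have hJ : ∀ n, CMDiffAt ∞ (T% (g.app ((Q.J n).app Z) V • (Q.J n).app q)) x := fun n ↦
    (hg.contMDiffAt_app ((Q.smooth n).contMDiffAt_app hZ) hV).smul_section
      ((Q.smooth n).contMDiffAt_app hq)
  have h := ((hg.contMDiffAt_app hZ hV).smul_section hq).add_section
    (((hJ 0).add_section (hJ 1)).add_section (hJ 2))
  refine h.congr_of_eventuallyEq (Filter.Eventually.of_forall fun y ↦ ?_)
  simp [quatRankOne_apply]

omit [FiniteDimensional ℝ E] [CompleteSpace E] in
lemma contMDiffAt_correction (hg : g.Smooth) {U V S₀ : VField I M} {S : Fin 3 → VField I M}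
    {l p t y : M → ℝ} {x : M} (hX : CMDiffAt ∞ (T% X) x) (hU : CMDiffAt ∞ (T% U) x)
    (hV : CMDiffAt ∞ (T% V) x) (hS₀ : CMDiffAt ∞ (T% S₀) x) (hS : ∀ n, CMDiffAt ∞ (T% (S n)) x)
    (hl : CMDiffAt ∞ l x) (hp : CMDiffAt ∞ p x) (ht : CMDiffAt ∞ t x) (hy : CMDiffAt ∞ y x)
    (h0 : 1 + l x * g.app X X x ≠ 0) :
    CMDiffAt ∞ (T% fun x ↦ correction (g x) (fun n ↦ Q.J n x) (X x) (fun _ ↦ S₀ x)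
      (fun n _ ↦ S n x) (l x) (p x) (t x) (y x) (U x) (V x)) x := by
  have hJX := fun n ↦ (Q.smooth n).contMDiffAt_app hX
  have hJ : ∀ n, CMDiffAt ∞ (T% (g.app ((Q.J n).app X) U • S n)) x := fun n ↦
    (hg.contMDiffAt_app (hJX n) hU).smul_section (hS n)
  have hR : CMDiffAt ∞ (T% (p • U + y • fun x ↦
      quatRankOne (g x) (fun n ↦ Q.J n x) (X x) (X x) (U x))) x :=
    (hp.smul_section hU).add_section
      (hy.smul_section (contMDiffAt_quatRankOne hg hX hX hU))
  have pre : CMDiffAt ∞ (T% fun x ↦ preCorrection (g x) (fun n ↦ Q.J n x) (X x) (fun _ ↦ S₀ x)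
      (fun n _ ↦ S n x) (l x) (p x) (t x) (y x) (U x) (V x)) x :=
    (((hl.smul_section (((hg.contMDiffAt_app hX hU).smul_section hS₀).add_section
      (((hJ 0).add_section (hJ 1)).add_section (hJ 2)))).add_section
      ((hp.mul (hg.contMDiffAt_app hX hU)).smul_section hV)).add_section
      (contMDiffAt_quatRankOne hg hX hR hV)).add_section
      (ht.smul_section (contMDiffAt_quatRankOne hg hU hX hV))
  have hd : CMDiffAt ∞ (fun x ↦ l x / (1 + l x * g.app X X x)) x :=
    hl.div₀ (contMDiffAt_const.add (hl.mul (hg.contMDiffAt_app hX hX))) h0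
  exact pre.sub_section (hd.smul_section (contMDiffAt_quatRankOne hg hX hX pre))

end DeformedConnection

section DeformedHKT

variable {E : Type*} [NormedAddCommGroup E] [NormedSpace ℝ E]
  {H : Type*} [TopologicalSpace H] {I : ModelWithCorners ℝ E H}
  {M : Type*} [TopologicalSpace M] [ChartedSpace H M] [IsManifold I ∞ M]
  [FiniteDimensional ℝ E] [CompleteSpace E]
  {Q : Hypercomplex I M} {g : BilinField I M}
  {D : CovariantDerivative I E (TangentSpace I : M → Type _)} {X : VField I M} {a b κ c : ℝ}

/-- Adding a one-form with values in the endomorphisms changes the torsion by its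
antisymmetrization. -/
lemma torsion_addOneForm
    (A : (x : M) → TangentSpace I x →L[ℝ] TangentSpace I x →L[ℝ] TangentSpace I x)
    (x : M) (u v : TangentSpace I x) :
    (D.addOneForm A).torsion x u v = D.torsion x u v + (A x v u - A x u v) := by
  simp only [CovariantDerivative.torsion_apply_eq_extend, CovariantDerivative.addOneForm,
    add_apply, FiberBundle.extend_apply_self]
  abel

section

variable (hg : IsHyperhermitian Q g) (hD : IsHKTConnection Q g D)
  (hX : IsSpecialHomothety Q g X a b) {σ : VField I M} {x : M}
include hD

lemma IsHKTConnection.contMDiffAt_cov (hσ : CMDiff ∞ (T% σ)) {U : VField I M}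
    (hU : CMDiffAt ∞ (T% U) x) : CMDiffAt ∞ (T% fun x ↦ D σ x (U x)) x := by
  have hDσ := hD.smooth.contMDiff.contMDiff (σ := σ) (contMDiffOn_univ.2 (hσ.of_le (by simp)))
  rw [contMDiffOn_univ] at hDσ
  exact ContMDiffAt.clm_bundle_apply (F₁ := E) (F₂ := E) (hDσ x) hU

include hg hX

lemma contMDiffAt_torsion_X (hσ : CMDiff ∞ (T% σ)) :
    CMDiffAt ∞ (T% fun x ↦ D.torsion x (X x) (σ x)) x := by
  have h := ((hD.contMDiffAt_cov hσ (hX.smooth x)).sub_section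
    ((hσ x).const_smul_section (a := a / 2))).sub_section (contMDiffAt_mlieBracket hX.smooth hσ)
  exact h.congr_of_eventuallyEq (Filter.Eventually.of_forall fun y ↦
    congrArg (TotalSpace.mk' E y) (hX.torsion_X hg hD ((hσ y).mdifferentiableAt (by simp))))

lemma contMDiffAt_torsion_J_X (hσ : CMDiff ∞ (T% σ)) (n : Fin 3) :
    CMDiffAt ∞ (T% fun x ↦ D.torsion x (Q.J n x (X x)) (σ x) +
      ((a + b) / 2) • Q.J n x (σ x)) x := by
  have hXJ : CMDiff ∞ (T% ((Q.J n).app X)) := fun y ↦ (Q.smooth n).contMDiffAt_app (hX.smooth y)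
  have hJσ := (Q.smooth n).contMDiffAt_app (hσ x)
  have h := (((hD.contMDiffAt_cov hσ (hXJ x)).sub_section
    (hJσ.const_smul_section (a := a / 2))).sub_section
      (contMDiffAt_mlieBracket hXJ hσ)).add_section (hJσ.const_smul_section (a := (a + b) / 2))
  exact h.congr_of_eventuallyEq (Filter.Eventually.of_forall fun y ↦
    congrArg (fun z ↦ TotalSpace.mk' E y (z + ((a + b) / 2) • Q.J n y (σ y)))
      (hX.torsion_J_X hg hD n ((hσ y).mdifferentiableAt (by simp))))

lemma smooth_deformedConnection (hr : ∀ x, g.app X X x ≠ 0) (hc : 1 + c ≠ 0) :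
    (D.addOneForm (correctionField Q g D X a b κ c)).ContMDiffCovariantDerivative ∞ := by
  refine ⟨⟨fun {σ} hσ ↦ ?_⟩⟩
  have hσ' : CMDiff ∞ (T% σ) := (contMDiffOn_univ.1 hσ).of_le (by simp)
  intro x _
  refine ContMDiffAt.contMDiffWithinAt ?_
  refine contMDiffAt_hom_of_apply (E₁ := fun x : M ↦ TangentSpace I x)
    (E₂ := fun x : M ↦ TangentSpace I x) fun U hU ↦ ?_
  have dr := hg.smooth.contMDiffAt_app (hX.smooth x) (hX.smooth x)
  have hl : CMDiffAt ∞ (fun x ↦ c / g.app X X x) x := contMDiffAt_const.div₀ dr (hr x)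
  have hy : CMDiffAt ∞ (fun x ↦ c / g.app X X x * (a * (κ - 1) / (2 * g.app X X x))) x :=
    hl.mul (contMDiffAt_const.div₀ (contMDiffAt_const.mul dr) (by simpa using hr x))
  have hcorr := contMDiffAt_correction (Q := Q) hg.smooth (hX.smooth x) hU (hσ' x)
    (contMDiffAt_torsion_X hg hD hX hσ') (contMDiffAt_torsion_J_X hg hD hX hσ') hl
    ((contMDiffAt_const (c := (a - b) / 2)).mul hl) ((contMDiffAt_const (c := b / 2)).mul hl) hy
    (by rwa [div_mul_cancel₀ _ (hr x)])
  have h := (hD.contMDiffAt_cov hσ' hU).add_section hcorr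
  refine h.congr_of_eventuallyEq (Filter.Eventually.of_forall fun y ↦
    congrArg (fun z ↦ TotalSpace.mk' E y (D σ y (U y) + z)) ?_)
  exact (correctionField_apply y (U y) (σ y)).trans (correction_congr rfl fun _ ↦ rfl)

end

/-- The deformed metric is HKT provided that `(a - b) c = a κ`. -/
lemma isHKTConnection_deformed (hg : IsHyperhermitian Q g) (hD : IsHKTConnection Q g D)
    (hX : IsSpecialHomothety Q g X a b) (hr : ∀ x, g.app X X x ≠ 0) (hc : 1 + c ≠ 0)
    (habc : (a - b) * c = a * κ) :
    IsHKTConnection Q (deformedMetric Q g X κ c)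
      (D.addOneForm (correctionField Q g D X a b κ c)) := by
  have hS₀ : ∀ x (v w : TangentSpace I x),
      g x (D.torsion x (X x) v) w = -g x v (D.torsion x (X x) w) := fun x ↦
    hD.torsion_skew hg x (X x)
  have hS : ∀ x (n : Fin 3) (v w : TangentSpace I x),
      g x (D.torsion x (Q.J n x (X x)) v + ((a + b) / 2) • Q.J n x v) w =
        -g x v (D.torsion x (Q.J n x (X x)) w + ((a + b) / 2) • Q.J n x w) := by
    intro x n v w
    have h := (hg.formAt x).apply_right n v w
    simp only [map_add, map_smul, add_apply, smul_apply, smul_eq_mul, h,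
      hD.torsion_skew hg x (Q.J n x (X x)) v w]
    ring
  have hl : ∀ x, 1 + c / g.app X X x * g x (X x) (X x) ≠ 0 := fun x ↦ by
    have := div_mul_cancel₀ c (hr x)
    rw [BilinField.app_apply] at this ⊢
    rwa [this]
  have hform : ∀ x, deformedMetric Q g X κ c x = deformedForm (g x) (fun n ↦ Q.J n x) (X x)
      ((g.app X X x ^ 2) ^ (κ / 2)) (c / g.app X X x * (g.app X X x ^ 2) ^ (κ / 2)) := fun x ↦ by
    rw [deformedMetric]
    congr 1
    ring
  -- `g'(w, A_u v) = φ g(w, B_u v)`, where `B` is the correction before inversion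
  have hA : ∀ x (u v w : TangentSpace I x),
      deformedMetric Q g X κ c x w (correctionField Q g D X a b κ c x v u) =
        (g.app X X x ^ 2) ^ (κ / 2) * g x w (preCorrection (g x) (fun n ↦ Q.J n x) (X x)
          (D.torsion x (X x))
          (fun n v ↦ D.torsion x (Q.J n x (X x)) v + ((a + b) / 2) • Q.J n x v)
          (c / g.app X X x) ((a - b) / 2 * (c / g.app X X x)) (b / 2 * (c / g.app X X x))
          (c / g.app X X x * (a * (κ - 1) / (2 * g.app X X x))) u v) := fun x u v w ↦ by
    rw [hform, correctionField_apply, (hg.formAt x).deformed_correction (hl x)]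
  refine ⟨smooth_deformedConnection hg hD hX hr hc, ?_, ?_, ?_⟩
  · intro V W x u hV hW
    have hx := hX.mdifferentiableAt x
    have hJ := fun n ↦ hX.mdifferentiableAt_app n x
    have hM := fun {V W : VField I M} ↦ hD.metric V W x u
    have key := (hg.formAt x).preCorrection_metric (X := X x) (l := c / g.app X X x)
      (p := (a - b) / 2 * (c / g.app X X x)) (t := b / 2 * (c / g.app X X x))
      (y := c / g.app X X x * (a * (κ - 1) / (2 * g.app X X x)))
      (hS₀ x) (hS x) u (V x) (W x)
    rw [mvfderiv_deformedMetric hg hx (hr x) hV hW u (ρ := a * g x (X x) u / g.app X X x)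
      (by
        rw [hM hx hx, hX.cov_X hg hD, div_mul_cancel₀ _ (hr x)]
        simp only [map_smul, smul_apply, smul_eq_mul, hg.symm x u]
        ring) (hM hV hW) (hM hx hV) (hM hx hW)
      (fun n ↦ hM (hJ n) hV) (fun n ↦ hM (hJ n) hW)]
    have hsymm : deformedMetric Q g X κ c x (correctionField Q g D X a b κ c x (V x) u) (W x) =
        deformedMetric Q g X κ c x (W x) (correctionField Q g D X a b κ c x (V x) u) :=
      (hg.formAt x).deformed_symm _ _ _ _ _
    simp only [CovariantDerivative.addOneForm, map_add, add_apply]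
    rw [hsymm, hA, hA, hg.symm x (W x)]
    simp only [deformedMetric_apply, hX.cov_X hg hD, hX.cov_J_X hg hD, map_smul, smul_apply,
      smul_eq_mul, BilinField.app_apply, EndField.app_apply]
    simp only [quatRankOne_apply, map_add, map_smul, add_apply, smul_apply, smul_eq_mul,
      BilinField.app_apply] at key
    have hab : (a - b) * c / g x (X x) (X x) = a * κ / g x (X x) (X x) := by rw [habc]
    linear_combination (-(g x (X x) (X x) ^ 2) ^ (κ / 2)) * key -
      (g x (X x) (X x) ^ 2) ^ (κ / 2) * g x (X x) u * g x (V x) (W x) * hab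
  · intro n V x u hV
    have h := (hg.formAt x).correction_comm (X := X x) (S₀ := D.torsion x (X x))
      (S := fun n v ↦ D.torsion x (Q.J n x (X x)) v + ((a + b) / 2) • Q.J n x v)
      (l := c / g.app X X x) (p := (a - b) / 2 * (c / g.app X X x))
      (t := b / 2 * (c / g.app X X x))
      (y := c / g.app X X x * (a * (κ - 1) / (2 * g.app X X x)))
      (fun n v ↦ hX.torsion_X_comm hg hD n x v) (fun m n v ↦ hX.torsion_J_X_comm hg hD m n x v)
      n u (V x)
    simp only [CovariantDerivative.addOneForm, add_apply, map_add, hD.complex n V x u hV,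
      EndField.app_apply, correctionField_apply, h]
  · -- a trilinear form vanishing when its first two arguments agree is skew in them
    have diag : ∀ x (u w : TangentSpace I x), deformedMetric Q g X κ c x u
        ((D.addOneForm (correctionField Q g D X a b κ c)).torsion x u w) = 0 := by
      intro x u w
      have key := (hg.formAt x).preCorrection_torsion (X := X x) (l := c / g.app X X x)
        (p := (a - b) / 2 * (c / g.app X X x)) (t := b / 2 * (c / g.app X X x))
        (y := c / g.app X X x * (a * (κ - 1) / (2 * g.app X X x)))
        (hD.skew x) (fun v ↦ rfl) (e := (a + b) / 2)
        (S := fun n v ↦ D.torsion x (Q.J n x (X x)) v + ((a + b) / 2) • Q.J n x v)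
        (fun n v ↦ rfl) (by ring) u w
      rw [torsion_addOneForm, map_add, map_sub, hA, hA]
      rw [map_sub] at key
      have e : deformedMetric Q g X κ c x u (D.torsion x u w) =
          (g.app X X x ^ 2) ^ (κ / 2) * (g x u (D.torsion x u w) + c / g.app X X x *
            g x (quatRankOne (g x) (fun n ↦ Q.J n x) (X x) (X x) u) (D.torsion x u w)) := by
        rw [hform]
        simp only [deformedForm, add_apply, smul_apply, ContinuousLinearMap.comp_apply,
          smul_eq_mul]
        ring
      rw [e]
      linear_combination ((g.app X X x ^ 2) ^ (κ / 2)) * key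
    intro x u v w
    refine ⟨by rw [CovariantDerivative.torsion_antisymm, map_neg], ?_⟩
    have h := diag x (u + v) w
    simp only [map_add, add_apply, diag] at h
    linarith

end DeformedHKT

/-! ### Changing the parameter -/

/-- A definite metric with a `D(2,1;α)`-symmetry, `α ≠ 0, -1`, can be deformed to one with a
`D(2,1;α')`-symmetry for every `α'` of the same sign as `α`, with the same vector field. -/
lemma IsDefiniteHKTWithD21.exists_deformed
    {E : Type*} [NormedAddCommGroup E] [NormedSpace ℝ E]
    {H : Type*} [TopologicalSpace H] {I : ModelWithCorners ℝ E H}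
    {M : Type*} [TopologicalSpace M] [ChartedSpace H M] [IsManifold I ∞ M]
    [FiniteDimensional ℝ E] [CompleteSpace E]
    {Q : Hypercomplex I M} {g : BilinField I M} {X : VField I M} {α α' : ℝ}
    (hM : IsDefiniteHKTWithD21 Q g X α) (hα : α ≠ 0) (hα₁ : α ≠ -1) (hα' : 0 < α' / α) :
    ∃ g' : BilinField I M, IsDefiniteHKTWithD21 Q g' X α' := by
  obtain ⟨⟨hg, D, hD⟩, hdef, hX₀, a, b, hb, hab, hX⟩ := hM
  have hr : ∀ x, g.app X X x ≠ 0 := hdef.app_ne_zero hX₀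
  have hα₁' : α + 1 ≠ 0 := fun h ↦ hα₁ (by linarith)
  have ha : a = (α + 1) * b := by rw [hab, div_mul_cancel₀ _ hb]
  -- `κ` is forced by the type `((κ + 1) a, b)` of `X` for the new metric, and `c` by
  -- `(a - b) c = a κ`; then `1 + c = α' / α`
  set κ : ℝ := (α' + 1) / (α + 1) - 1 with hκ
  set c : ℝ := α' / α - 1 with hcdef
  have hc : 0 < 1 + c := by simpa [hcdef] using hα'
  have habc : (a - b) * c = a * κ := by
    rw [ha, hκ, hcdef]
    field_simp
    ring
  refine ⟨deformedMetric Q g X κ c,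
    ⟨isHyperhermitian_deformedMetric hg hdef hX.smooth hX₀ hc,
      _, isHKTConnection_deformed hg hD hX hr hc.ne' habc⟩,
    isDefinite_deformedMetric hg hdef hX₀ hc, hX₀,
    (κ + 1) * a, b, hb, ?_, hX.deformedMetric hg hr κ c⟩
  rw [ha, hκ]
  field_simp
  ring

end HKT

end

theorem mainTheorem5 (m : ℕ) {M : Type*} [TopologicalSpace M] [T2Space M]
    [SecondCountableTopology M] [ChartedSpace (EuclideanSpace ℝ (Fin (4 * m))) M]
    [IsManifold (𝓡 (4 * m)) ∞ M]
    (Q : HKT.Hypercomplex (𝓡 (4 * m)) M) (g : HKT.BilinField (𝓡 (4 * m)) M)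
    (X : HKT.VField (𝓡 (4 * m)) M) (α : ℝ) (hM : HKT.IsDefiniteHKTWithD21 Q g X α) :
    (0 < α → ∀ α' : ℝ, 0 < α' →
      ∃ (g' : HKT.BilinField (𝓡 (4 * m)) M) (X' : HKT.VField (𝓡 (4 * m)) M),
        HKT.IsDefiniteHKTWithD21 Q g' X' α') ∧
    (α < 0 → α ≠ -1 → ∀ α' : ℝ, α' < 0 →
      ∃ (g' : HKT.BilinField (𝓡 (4 * m)) M) (X' : HKT.VField (𝓡 (4 * m)) M),
        HKT.IsDefiniteHKTWithD21 Q g' X' α') := by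
  refine ⟨fun hα α' hα' ↦ ?_, fun hα hα₁ α' hα' ↦ ?_⟩
  · obtain ⟨g', h⟩ := hM.exists_deformed hα.ne' (by linarith) (div_pos hα' hα)
    exact ⟨g', X, h⟩
  · obtain ⟨g', h⟩ := hM.exists_deformed hα.ne hα₁ (div_pos_of_neg_of_neg hα' hα)
    exact ⟨g', X, h⟩
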